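/- All graphs are finite and simple. A graph is planar if it can be drawn in the plane with vertices as distinct points and edges as (polygonal) arcs that meet only in common ends. For a graph $H$, an orientation of its edges, an Abelian group $A$ and $f\colon E(H)\to A$, an $(A,f)$-coloring is a map $c\colon V(H)\to A$ with $c(u)-c(v)\neq f(uv)$ for every edge $uv$ directed from $u$ to $v$. The graph $H$ is $A$-colorable if it has an $(A,f)$-coloring for every $f$ (under every orientation; the choice of orientation is immaterial). It is group $k$-choosable if for every Abelian group $A$ with $|A|\ge k$, every assignment of lists $L(v)\subseteq A$ with $|L(v)|=k$, and every $f\colon E(H)\to A$, it has an $(A,f)$-coloring $c$ with $c(v)\in L(v)$ for all $v$. Let $\chi_g(H)$ be the least $m$ such that $H$ is $A$-colorable for every Abelian group $A$ with $|A|\ge m$, and let $\chi_{gl}(H)$ be the least $k$ such that $H$ is group $k$-choosable. With $\mathcal L(G)$ the line graph of $G$, put $\chi'_g(G)=\chi_g(\mathcal L(G))$ and $\chi'_{gl}(G)=\chi_{gl}(\mathcal L(G))$. **Theorem.** Let $\Delta\ge 3$ be an integer and let $G$ be a planar graph with maximum degree $\Delta(G)\ge\Delta$. If the girth of $G$ (the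 length of a shortest cycle, $+\infty$ if $G$ is a forest) satisfies $$g(G)\ \ge\ 4+\left\lceil\frac{8}{\Delta-2}\right\rceil,$$ then $\chi'_g(G)=\chi'_{gl}(G)=\Delta(G)$. -/

import Mathlib

universe u w

namespace SimpleGraph

/-! ### Group colorings -/

/-- An orientation of the edges of `G`: `D.Dir u v` says that `uv` is an edge directed from `u`
to `v`. Every edge gets exactly one of its two directions. -/
structure EdgeOrientation {V : Type u} (G : SimpleGraph V) where
  Dir : V → V → Prop
  adj_of_dir : ∀ {u v : V}, Dir u v → G.Adj u v
  dir_or_dir : ∀ {u v : V}, G.Adj u v → Dir u v ∨ Dir v u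
  asymm : ∀ {u v : V}, Dir u v → ¬ Dir v u

/-- `c` is an `(A, f)`-coloring of `G` under the orientation `D`: `c u - c v ≠ f (uv)` for every
edge `uv` directed from `u` to `v`. -/
def IsGroupColoring {V : Type u} {G : SimpleGraph V} {A : Type w} [AddCommGroup A]
    (D : G.EdgeOrientation) (f : G.edgeSet → A) (c : V → A) : Prop :=
  ∀ (u v : V) (h : D.Dir u v), c u - c v ≠ f ⟨s(u, v), D.adj_of_dir h⟩

/-- `G` is `A`-colorable: under every orientation `D`, and for every `f : E(G) → A`, there is an
`(A, f)`-coloring. -/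
def IsGroupColorable {V : Type u} (G : SimpleGraph V) (A : Type w) [AddCommGroup A] : Prop :=
  ∀ (D : G.EdgeOrientation) (f : G.edgeSet → A), ∃ c : V → A, IsGroupColoring D f c

/-- `G` is group `k`-choosable: for every Abelian group `A` of order at least `k` (possibly
infinite), every `k`-uniform list assignment `L`, every orientation `D` and every `f : E(G) → A`
there is an `(A, f)`-coloring `c` with `c v ∈ L v` for all vertices `v`. -/
def IsGroupChoosable {V : Type u} (G : SimpleGraph V) (k : ℕ) : Prop :=
  ∀ (A : Type w) [AddCommGroup A], (k : ℕ∞) ≤ ENat.card A →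
    ∀ L : V → Finset A, (∀ v, (L v).card = k) →
      ∀ (D : G.EdgeOrientation) (f : G.edgeSet → A),
        ∃ c : V → A, IsGroupColoring D f c ∧ ∀ v, c v ∈ L v

/-- The group chromatic number: the least `m` such that `G` is `A`-colorable for every Abelian
group `A` of order at least `m` (and `⊤` if there is no such `m`). -/
noncomputable def groupChromaticNumber {V : Type u} (G : SimpleGraph V) : ℕ∞ :=
  ⨅ m ∈ {m : ℕ | ∀ (A : Type w) [AddCommGroup A],
    (m : ℕ∞) ≤ ENat.card A → G.IsGroupColorable A}, (m : ℕ∞)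

/-- The group choice number: the least `k` such that `G` is group `k`-choosable (and `⊤` if there
is no such `k`). -/
noncomputable def groupChoiceNumber {V : Type u} (G : SimpleGraph V) : ℕ∞ :=
  ⨅ k ∈ {k : ℕ | IsGroupChoosable.{u, w} G k}, (k : ℕ∞)

/-- The group edge chromatic number: the group chromatic number of the line graph. -/
noncomputable def groupEdgeChromaticNumber {V : Type u} (G : SimpleGraph V) : ℕ∞ :=
  groupChromaticNumber.{u, w} G.lineGraph

/-- The group edge choice number: the group choice number of the line graph. -/
noncomputable def groupEdgeChoiceNumber {V : Type u} (G : SimpleGraph V) : ℕ∞ :=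
  groupChoiceNumber.{u, w} G.lineGraph

/-! ### Planar graphs -/

/-- `P` is a (polygonal) arc in the plane with ends `x` and `y`: the union of the segments
`[p₀, p₁], …, [pₙ₋₁, pₙ]` of a polygonal chain from `p₀ = x` to `pₙ = y` with `n ≥ 1` that does not
meet itself, i.e. consecutive segments share only their common corner and all other pairs of
segments are disjoint. -/
def IsPolygonalArc (P : Set (ℝ × ℝ)) (x y : ℝ × ℝ) : Prop :=
  ∃ (n : ℕ) (p : ℕ → ℝ × ℝ), 0 < n ∧ p 0 = x ∧ p n = y ∧
    Set.InjOn p (Set.Iic n) ∧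
    (∀ i, i + 1 < n →
      segment ℝ (p i) (p (i + 1)) ∩ segment ℝ (p (i + 1)) (p (i + 2)) = {p (i + 1)}) ∧
    (∀ i j, i + 1 < j → j < n →
      Disjoint (segment ℝ (p i) (p (i + 1))) (segment ℝ (p j) (p (j + 1)))) ∧
    P = ⋃ i ∈ Set.Iio n, segment ℝ (p i) (p (i + 1))

/-- A drawing of `G` in the plane without crossings: the vertices are distinct points, every edge
is an arc between its two ends that contains no other vertex, and two different edges meet only in
common ends. -/
structure PlaneDrawing {V : Type u} (G : SimpleGraph V) where
  point : V → ℝ × ℝ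
  point_injective : Function.Injective point
  arc : G.edgeSet → Set (ℝ × ℝ)
  isPolygonalArc : ∀ (u v : V) (h : G.Adj u v),
    IsPolygonalArc (arc ⟨s(u, v), h⟩) (point u) (point v)
  mem_of_point_mem : ∀ (e : G.edgeSet) (v : V), point v ∈ arc e → v ∈ (e : Sym2 V)
  inter_subset : ∀ e e' : G.edgeSet, e ≠ e' → ∀ q ∈ arc e ∩ arc e',
    ∃ v : V, v ∈ (e : Sym2 V) ∧ v ∈ (e' : Sym2 V) ∧ q = point v

/-- A graph is planar if it can be drawn in the plane without crossings. -/
def IsPlanar {V : Type u} (G : SimpleGraph V) : Prop :=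
  Nonempty G.PlaneDrawing

end SimpleGraph

/-!
In suitable coordinates, the segments of a plane drawing are graphs of functions on intervals. Every
cycle has a winding parity around a point, which is the flux of the cycle through the arcs below
the point, and two points lie in the same face when all cycles have equal parities around them.
Crossing an arc changes the parities of the cycles through that arc only, so the face boundaries
span the cycle space and every edge is in at most two of them; neither the Jordan curve theorem nor
the connectedness of faces is needed. Adding up the lengths of the boundaries gives Euler's
inequality for graphs of girth at least `g`.

If all edges `xy` satisfied `deg x + deg y ≥ Δ(G) + 2`, then `∑ (1 / deg x + 1 / deg y)` over the
edges would bound the number of vertices that are not isolated by `(Δ(G) + 2) / (2 Δ(G))` times the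
number of edges, which contradicts Euler's inequality. The same applies to all subgraphs of `G`, so
every nonempty set of vertices of the line graph contains one with fewer than `Δ(G)` neighbours in
the set, and lists of size `Δ(G)` suffice for a greedy coloring. Conversely, the edges at a vertex
of maximum degree form a clique of the line graph, whose vertices all get different colors if
`f = 0`.
-/

open scoped Finset

/-! ### Circulations and monotone arcs -/

open scoped Classical in
/-- `χ` is a circulation on the directed multigraph whose edge `e` runs from `s e` to `t e`: at
every vertex the inflow equals the outflow. -/
def IsCirculation {E P M : Type*} [Fintype E] [AddCommMonoid M] (s t : E → P) (χ : E → M) : Prop :=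
  ∀ p, ∑ e with s e = p, χ e = ∑ e with t e = p, χ e

open scoped Classical in
theorem IsCirculation.sum_filter_eq {E P M : Type*} [Fintype E] [AddCommMonoid M] {s t : E → P}
    {χ : E → M} (hχ : IsCirculation s t χ) (Q : P → Prop) :
    ∑ e with Q (s e), χ e = ∑ e with Q (t e), χ e := by
  have sum_fiberwise (r : E → P) (hr : ∀ e, r e ∈ Finset.univ.image s ∪ Finset.univ.image t) :
      ∑ e with Q (r e), χ e =
        ∑ p ∈ Finset.univ.image s ∪ Finset.univ.image t with Q p, ∑ e with r e = p, χ e := by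
    simp only [Finset.sum_filter]
    rw [← Finset.sum_fiberwise_of_maps_to (g := r) fun e _ => hr e]
    simp only [Finset.sum_filter]
    refine Finset.sum_congr rfl fun p _ => ?_
    split_ifs with hp
    · exact Finset.sum_congr rfl fun e _ => by split_ifs <;> simp_all
    · exact Finset.sum_eq_zero fun e _ => by split_ifs <;> simp_all
  rw [sum_fiberwise s (by simp), sum_fiberwise t (by simp)]
  exact Finset.sum_congr rfl fun p _ => hχ p

theorem sum_sub_telescope_of_injOn {ι α M G : Type*} [LinearOrder α] [AddCommMonoid M]
    [AddCommGroup G] {R : Finset ι} {σ : ι → α} (hσ : Set.InjOn σ R) (χ : ι → M) (g : M → G)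
    (β : M) :
    ∑ e ∈ R, (g (β + ∑ e' ∈ R with σ e' < σ e, χ e' + χ e) -
      g (β + ∑ e' ∈ R with σ e' < σ e, χ e')) = g (β + ∑ e ∈ R, χ e) - g β := by
  classical
  induction R using Finset.induction_on_max_value σ with
  | empty => simp
  | insert a s ha hmax ih =>
    have hlt : ∀ e ∈ s, σ e < σ a := fun e he => (hmax e he).lt_of_ne fun h =>
      ha (hσ (by simp [he]) (by simp) h ▸ he)
    have filter_top : {e' ∈ insert a s | σ e' < σ a} = s := by
      rw [Finset.filter_insert, if_neg (lt_irrefl _), Finset.filter_true_of_mem hlt]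
    have filter_lower : ∀ e ∈ s, {e' ∈ insert a s | σ e' < σ e} = {e' ∈ s | σ e' < σ e} :=
      fun e he => by rw [Finset.filter_insert, if_neg (hlt e he).not_gt]
    have hsum := ih (hσ.mono (by simp))
    rw [Finset.sum_congr rfl fun e he => by rw [← filter_lower e he]] at hsum
    rw [Finset.sum_insert ha, Finset.sum_insert ha, filter_top, hsum, add_comm (χ a), add_assoc,
      sub_add_sub_cancel]

/-- A plane drawing of a multigraph with edges `E` by graphs of continuous functions over compact
intervals. Distinct vertices are required to have distinct abscissae, so a vertex is encoded by its
abscissa `x` alone; it is the point `(x, ordinate x)`. Values of `ordinate` elsewhere are junk. -/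
structure MonotoneArcSystem (E : Type*) where
  left : E → ℝ
  right : E → ℝ
  height : E → ℝ → ℝ
  ordinate : ℝ → ℝ
  left_lt_right : ∀ e, left e < right e
  continuousOn_height : ∀ e, ContinuousOn (height e) (Set.Icc (left e) (right e))
  height_left : ∀ e, height e (left e) = ordinate (left e)
  height_right : ∀ e, height e (right e) = ordinate (right e)
  eq_end_of_height_eq : ∀ {e e'}, e ≠ e' → ∀ {x}, x ∈ Set.Icc (left e) (right e) →
    x ∈ Set.Icc (left e') (right e') → height e x = height e' x → x = left e ∨ x = right e

namespace MonotoneArcSystem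

variable {E : Type*} (S : MonotoneArcSystem E) {e e' : E} {x : ℝ}

/-- The abscissae of the points of an arc. -/
def dom (e : E) : Set ℝ := Set.Icc (S.left e) (S.right e)

/-- The abscissae of the points of an arc other than its ends. -/
def innerDom (e : E) : Set ℝ := Set.Ioo (S.left e) (S.right e)

theorem innerDom_subset_dom : S.innerDom e ⊆ S.dom e := Set.Ioo_subset_Icc_self

theorem left_mem_dom : S.left e ∈ S.dom e := Set.left_mem_Icc.2 (S.left_lt_right e).le

theorem height_ne (hne : e ≠ e') (hx : x ∈ S.innerDom e) (hx' : x ∈ S.dom e') :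
    S.height e x ≠ S.height e' x := fun h =>
  (S.eq_end_of_height_eq hne (S.innerDom_subset_dom hx) hx' h).elim hx.1.ne' hx.2.ne

/-- The arc `e'` runs below `e` over some common inner abscissa. -/
def Below (e' e : E) : Prop :=
  ∃ x ∈ S.innerDom e ∩ S.innerDom e', S.height e' x < S.height e x

variable {S}

theorem Below.ne (h : S.Below e' e) : e ≠ e' := by
  rintro rfl
  obtain ⟨x, -, hx⟩ := h
  exact hx.false

theorem Below.left_lt_right (h : S.Below e' e) : S.left e < S.right e' :=
  let ⟨_, ⟨hx, hx'⟩, _⟩ := h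
  hx.1.trans hx'.2

theorem Below.left_lt_right' (h : S.Below e' e) : S.left e' < S.right e :=
  let ⟨_, ⟨hx, hx'⟩, _⟩ := h
  hx'.1.trans hx.2

theorem Below.height_lt (h : S.Below e' e) (hx : x ∈ S.dom e) (hx' : x ∈ S.dom e')
    (hin : x ∈ S.innerDom e ∨ x ∈ S.innerDom e') : S.height e' x < S.height e x := by
  obtain ⟨y, ⟨hy, hy'⟩, hlt⟩ := id h
  by_contra! hge
  have huIcc : Set.uIcc y x ⊆ S.dom e := Set.ordConnected_Icc.uIcc_subset
    (S.innerDom_subset_dom hy) hx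
  have huIcc' : Set.uIcc y x ⊆ S.dom e' := Set.ordConnected_Icc.uIcc_subset
    (S.innerDom_subset_dom hy') hx'
  obtain ⟨z, hz, hz0⟩ := intermediate_value_uIcc
    (((S.continuousOn_height e).mono huIcc).sub ((S.continuousOn_height e').mono huIcc'))
    (Set.mem_uIcc.2 (Or.inr ⟨sub_nonpos.2 hge, sub_nonneg.2 hlt.le⟩))
  have hzeq : S.height e z = S.height e' z := sub_eq_zero.1 hz0
  rcases hin with hin | hin
  · exact S.height_ne h.ne (Set.ordConnected_Ioo.uIcc_subset hy hin hz) (huIcc' hz) hzeq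
  · exact S.height_ne h.ne.symm (Set.ordConnected_Ioo.uIcc_subset hy' hin hz) (huIcc hz) hzeq.symm

theorem below_or_below (hne : e ≠ e') (hx : x ∈ S.innerDom e) (hx' : x ∈ S.dom e') :
    S.Below e' e ∨ S.Below e e' := by
  obtain ⟨y, hy, hy'⟩ : (S.innerDom e ∩ S.innerDom e').Nonempty := by
    rw [dom, ← closure_Ioo (S.left_lt_right e').ne] at hx'
    exact mem_closure_iff.1 hx' _ isOpen_Ioo hx
  exact (S.height_ne hne hy (S.innerDom_subset_dom hy')).lt_or_gt.symm.imp
    (fun h => ⟨y, ⟨hy, hy'⟩, h⟩) fun h => ⟨y, ⟨hy', hy⟩, h⟩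

theorem below_iff_height_lt (hx : x ∈ S.dom e) (hx' : x ∈ S.dom e')
    (hin : x ∈ S.innerDom e ∨ x ∈ S.innerDom e') :
    S.Below e' e ↔ S.height e' x < S.height e x := by
  refine ⟨fun h => h.height_lt hx hx' hin, fun h => ?_⟩
  have hne : e ≠ e' := by rintro rfl; exact h.false
  have hor : S.Below e' e ∨ S.Below e e' := hin.elim (fun hin => below_or_below hne hin hx')
    fun hin => (below_or_below hne.symm hin hx).symm
  exact hor.resolve_right fun h' => h.not_gt (h'.height_lt hx' hx hin.symm)

variable (S)

/-- The mirror image in the vertical axis, which exchanges left and right ends. -/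
def reflect : MonotoneArcSystem E where
  left e := -S.right e
  right e := -S.left e
  height e x := S.height e (-x)
  ordinate x := S.ordinate (-x)
  left_lt_right e := neg_lt_neg (S.left_lt_right e)
  continuousOn_height e := (S.continuousOn_height e).comp continuousOn_neg fun _ hx =>
    ⟨le_neg_of_le_neg hx.2, neg_le_of_neg_le hx.1⟩
  height_left e := by simpa using S.height_right e
  height_right e := by simpa using S.height_left e
  eq_end_of_height_eq hne x hx hx' h :=
    (S.eq_end_of_height_eq hne ⟨le_neg_of_le_neg hx.2, neg_le_of_neg_le hx.1⟩
      ⟨le_neg_of_le_neg hx'.2, neg_le_of_neg_le hx'.1⟩ h).symm.imp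
      neg_eq_iff_eq_neg.1 neg_eq_iff_eq_neg.1

/-- The arc `e` passes above the vertex with abscissa `x`. -/
def PassesAbove (e : E) (x : ℝ) : Prop := x ∈ S.innerDom e ∧ S.ordinate x < S.height e x

/-- The arc `e` passes below the vertex with abscissa `x`. -/
def PassesBelow (e : E) (x : ℝ) : Prop := x ∈ S.innerDom e ∧ S.height e x < S.ordinate x

@[simp]
theorem reflect_left : S.reflect.left e = -S.right e := rfl

theorem neg_mem_innerDom_reflect_iff : -x ∈ S.reflect.innerDom e ↔ x ∈ S.innerDom e := by
  simp [innerDom, reflect, and_comm]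

theorem reflect_passesAbove_neg_iff : S.reflect.PassesAbove e (-x) ↔ S.PassesAbove e x := by
  rw [PassesAbove, neg_mem_innerDom_reflect_iff]
  simp [PassesAbove, reflect]

theorem reflect_passesBelow_neg_iff : S.reflect.PassesBelow e (-x) ↔ S.PassesBelow e x := by
  rw [PassesBelow, neg_mem_innerDom_reflect_iff]
  simp [PassesBelow, reflect]

theorem reflect_below_iff : S.reflect.Below e' e ↔ S.Below e' e := by
  rw [Below, ← (Equiv.neg ℝ).exists_congr_left.symm]
  simp only [Equiv.neg_symm, Equiv.neg_apply, Set.mem_inter_iff, neg_mem_innerDom_reflect_iff]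
  simp [Below, reflect]

theorem passesAbove_left_iff :
    S.PassesAbove e (S.left e') ↔ S.Below e' e ∧ S.left e < S.left e' := by
  rw [PassesAbove, ← S.height_left]
  constructor
  · rintro ⟨hin, hlt⟩
    exact ⟨(below_iff_height_lt (S.innerDom_subset_dom hin) S.left_mem_dom (.inl hin)).2 hlt, hin.1⟩
  · rintro ⟨hbelow, hlt⟩
    have hin : S.left e' ∈ S.innerDom e := ⟨hlt, hbelow.left_lt_right'⟩
    exact ⟨hin, hbelow.height_lt (S.innerDom_subset_dom hin) S.left_mem_dom (.inl hin)⟩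

theorem passesBelow_left_iff :
    S.PassesBelow e' (S.left e) ↔ S.Below e' e ∧ S.left e' < S.left e := by
  rw [PassesBelow, ← S.height_left]
  constructor
  · rintro ⟨hin, hlt⟩
    exact ⟨(below_iff_height_lt S.left_mem_dom (S.innerDom_subset_dom hin) (.inr hin)).2 hlt, hin.1⟩
  · rintro ⟨hbelow, hlt⟩
    have hin : S.left e ∈ S.innerDom e' := ⟨hlt, hbelow.left_lt_right⟩
    exact ⟨hin, hbelow.height_lt S.left_mem_dom (S.innerDom_subset_dom hin) (.inr hin)⟩

theorem exists_forall_left_eq_mem_innerDom [Finite E] (x : ℝ) :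
    ∃ y, ∀ e, S.left e = x → y ∈ S.innerDom e := by
  have hnear : ∀ᶠ y in nhdsWithin x (Set.Ioi x), ∀ e, S.left e = x → y ∈ S.innerDom e :=
    Filter.eventually_all.2 fun e => Filter.eventually_imp_distrib_left.2 fun he =>
      Ioo_mem_nhdsGT_of_mem ⟨he.le, he ▸ S.left_lt_right e⟩
  exact hnear.exists

section Flux

variable [Fintype E]

open scoped Classical in
/-- The total flow through the arcs that pass below the arc `e` just to the right of its left end.
If `χ` is a circulation, it does not depend on the point of `e` that is used. -/
noncomputable def fluxBelow {M : Type*} [AddCommMonoid M] (χ : E → M) (e : E) : M :=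
  ∑ e' with S.Below e' e ∧ S.left e' ≤ S.left e, χ e'

open scoped Classical in
/-- The total flow through the arcs that pass below the vertex with abscissa `x`. -/
noncomputable def fluxBelowVertex {M : Type*} [AddCommMonoid M] (χ : E → M) (x : ℝ) : M :=
  ∑ e' with S.PassesBelow e' x, χ e'

theorem fluxBelowVertex_reflect_neg {M : Type*} [AddCommMonoid M] (χ : E → M) (x : ℝ) :
    S.reflect.fluxBelowVertex χ (-x) = S.fluxBelowVertex χ x := by
  unfold fluxBelowVertex
  congr! 2
  exact S.reflect_passesBelow_neg_iff

open scoped Classical in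
theorem fluxBelow_add_sum_passesAbove {M : Type*} [AddCommMonoid M] (χ : E → M) (e : E) :
    S.fluxBelow χ e + ∑ e' with S.PassesAbove e (S.left e'), χ e' =
      ∑ e' with S.Below e' e, χ e' := by
  rw [← Finset.sum_filter_add_sum_filter_not {e' | S.Below e' e} fun e' => S.left e' ≤ S.left e]
  simp only [fluxBelow, passesAbove_left_iff, Finset.filter_filter, not_le]

theorem fluxBelow_reflect {M : Type*} [AddCommGroup M] {χ : E → M}
    (hχ : IsCirculation S.left S.right χ) (e : E) :
    S.reflect.fluxBelow χ e = S.fluxBelow χ e := by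
  classical
  have hreflect := S.reflect.fluxBelow_add_sum_passesAbove χ e
  have hleft := S.fluxBelow_add_sum_passesAbove χ e
  simp only [reflect_below_iff, reflect_left, reflect_passesAbove_neg_iff] at hreflect
  rw [← hleft, hχ.sum_filter_eq] at hreflect
  exact add_right_cancel hreflect

open scoped Classical in
theorem fluxBelow_eq_fluxBelowVertex_left_add {M : Type*} [AddCommMonoid M] (χ : E → M) (e : E) :
    S.fluxBelow χ e =
      S.fluxBelowVertex χ (S.left e) + ∑ e' with S.left e' = S.left e ∧ S.Below e' e, χ e' := by
  rw [fluxBelow, ← Finset.sum_filter_add_sum_filter_not _ fun e' => S.left e' < S.left e]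
  simp only [fluxBelowVertex, Finset.filter_filter]
  congr! 3 with e'
  · rw [passesBelow_left_iff]
    grind
  · grind

/-- The change of `g`, applied to the flux below a point, when the point crosses `e` upwards. -/
noncomputable def jump {M G : Type*} [AddCommMonoid M] [AddCommGroup G] (χ : E → M) (g : M → G)
    (e : E) : G :=
  g (S.fluxBelow χ e + χ e) - g (S.fluxBelow χ e)

open scoped Classical in
theorem sum_jump_left {M G : Type*} [AddCommMonoid M] [AddCommGroup G] (χ : E → M) (g : M → G)
    (x : ℝ) :
    ∑ e with S.left e = x, S.jump χ g e =
      g (S.fluxBelowVertex χ x + ∑ e with S.left e = x, χ e) - g (S.fluxBelowVertex χ x) := by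
  obtain ⟨y, hy⟩ := S.exists_forall_left_eq_mem_innerDom x
  have hdom : ∀ e, S.left e = x → y ∈ S.dom e := fun e he => S.innerDom_subset_dom (hy e he)
  have hinj : Set.InjOn (S.height · y) ({e | S.left e = x} : Finset E) := by
    intro e he e' he' h
    simp only [Finset.coe_filter, Finset.mem_univ, true_and, Set.mem_ofPred_eq] at he he'
    by_contra hne
    exact S.height_ne hne (hy e he) (hdom e' he') h
  have hflux : ∀ e, S.left e = x → S.fluxBelow χ e =
      S.fluxBelowVertex χ x + ∑ e' with S.left e' = x ∧ S.height e' y < S.height e y, χ e' := by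
    rintro e rfl
    rw [fluxBelow_eq_fluxBelowVertex_left_add]
    congr 2
    refine Finset.filter_congr fun e' _ => and_congr_right fun he' => ?_
    exact below_iff_height_lt (hdom e rfl) (hdom e' he') (.inl (hy e rfl))
  rw [← sum_sub_telescope_of_injOn hinj]
  refine Finset.sum_congr rfl fun e he => ?_
  rw [jump, hflux e (Finset.mem_filter.1 he).2, Finset.filter_filter, add_assoc]

theorem isCirculation_jump {M G : Type*} [AddCommGroup M] [AddCommGroup G] {χ : E → M}
    (hχ : IsCirculation S.left S.right χ) (g : M → G) :
    IsCirculation S.left S.right (S.jump χ g) := by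
  classical
  intro x
  have hjump : S.reflect.jump χ g = S.jump χ g := by
    ext e
    simp only [jump, fluxBelow_reflect S hχ]
  have hright := S.reflect.sum_jump_left χ g (-x)
  simp only [hjump, fluxBelowVertex_reflect_neg, reflect_left, neg_inj] at hright
  rw [sum_jump_left, hright, hχ x]

end Flux

end MonotoneArcSystem

/-! ### Cycle spaces and twofold spanning sets -/

section CycleSpace

variable {E P : Type*}

open scoped Classical in
/-- The cycle space over `ZMod 2` of the multigraph whose edge `e` joins the two elements of
`ends e`. Loops are not intended: one would count only once at its vertex. -/
def cycleSpace [Fintype E] (ends : E → Sym2 P) : Submodule (ZMod 2) (E → ZMod 2) where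
  carrier := {C | ∀ p, ∑ e with p ∈ ends e, C e = 0}
  add_mem' hC hD p := by simp only [Pi.add_apply, Finset.sum_add_distrib, hC p, hD p, add_zero]
  zero_mem' p := by simp
  smul_mem' a C hC p := by simp only [Pi.smul_apply, ← Finset.smul_sum, hC p, smul_zero]

open scoped Classical in
theorem mem_cycleSpace [Fintype E] {ends : E → Sym2 P} {C : E → ZMod 2} :
    C ∈ cycleSpace ends ↔ ∀ p, ∑ e with p ∈ ends e, C e = 0 := Iff.rfl

theorem mem_cycleSpace_iff_isCirculation [Fintype E] {s t : E → P} (hne : ∀ e, s e ≠ t e)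
    {C : E → ZMod 2} : C ∈ cycleSpace (fun e => s(s e, t e)) ↔ IsCirculation s t C := by
  classical
  refine forall_congr' fun p => ?_
  simp only [Sym2.mem_iff, eq_comm (a := p), Finset.filter_or]
  rw [Finset.sum_union (Finset.disjoint_filter.2 fun e _ hs ht => hne e (hs.trans ht.symm)),
    CharTwo.add_eq_zero]

theorem cycleSpace_map [Fintype E] {Q : Type*} {ends : E → Sym2 P} {φ : P → Q}
    (hφ : Set.InjOn φ {p | ∃ e, p ∈ ends e}) :
    cycleSpace (fun e => (ends e).map φ) = cycleSpace ends := by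
  classical
  have mem_map {p : P} (hp : ∃ e, p ∈ ends e) (e : E) : φ p ∈ (ends e).map φ ↔ p ∈ ends e := by
    refine ⟨fun h => ?_, fun h => Sym2.mem_map.2 ⟨p, h, rfl⟩⟩
    obtain ⟨q, hq, hqp⟩ := Sym2.mem_map.1 h
    exact hφ ⟨e, hq⟩ hp hqp ▸ hq
  ext C
  simp only [mem_cycleSpace]
  constructor
  · intro h p
    by_cases hp : ∃ e, p ∈ ends e
    · simpa only [mem_map hp] using h (φ p)
    · exact Finset.sum_eq_zero fun e he => absurd ⟨e, (Finset.mem_filter.1 he).2⟩ hp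
  · intro h q
    by_cases hq : ∃ e, q ∈ (ends e).map φ
    · obtain ⟨e, he⟩ := hq
      obtain ⟨p, hp, rfl⟩ := Sym2.mem_map.1 he
      simpa only [mem_map ⟨e, hp⟩] using h p
    · exact Finset.sum_eq_zero fun e he => absurd ⟨e, (Finset.mem_filter.1 he).2⟩ hq

open scoped Classical in
theorem sum_card_ends_mem_mul_eq_zero [Fintype E] {ends : E → Sym2 P} {C : E → ZMod 2}
    (hC : C ∈ cycleSpace ends) (K : Finset P) :
    ∑ e, (#{v ∈ K | v ∈ ends e} : ZMod 2) * C e = 0 := by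
  calc ∑ e, (#{v ∈ K | v ∈ ends e} : ZMod 2) * C e
      = ∑ e, ∑ v ∈ K, if v ∈ ends e then C e else 0 := by
        simp only [Finset.card_filter, Nat.cast_sum, Nat.cast_ite, Nat.cast_one, Nat.cast_zero,
          Finset.sum_mul, ite_mul, one_mul, zero_mul]
    _ = ∑ v ∈ K, ∑ e with v ∈ ends e, C e := by
        rw [Finset.sum_comm]
        simp only [Finset.sum_filter]
    _ = 0 := Finset.sum_eq_zero fun v _ => hC v

/-- `Z` has a finite spanning set such that every element of `E` is in the support of at most two
of its members; for the cycle space of a graph this is MacLane's criterion for planarity. -/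
def HasTwofoldSpan (Z : Submodule (ZMod 2) (E → ZMod 2)) : Prop :=
  ∃ B : Finset (E → ZMod 2),
    Submodule.span (ZMod 2) (B : Set (E → ZMod 2)) = Z ∧ ∀ e, #{b ∈ B | b e ≠ 0} ≤ 2

theorem HasTwofoldSpan.map_funLeft {F : Type*} {Z : Submodule (ZMod 2) (E → ZMod 2)}
    (hZ : HasTwofoldSpan Z) (φ : F → E) :
    HasTwofoldSpan (Z.map (LinearMap.funLeft (ZMod 2) (ZMod 2) φ)) := by
  classical
  obtain ⟨B, hspan, htwo⟩ := hZ
  refine ⟨B.image (LinearMap.funLeft (ZMod 2) (ZMod 2) φ), ?_, fun f => ?_⟩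
  · rw [← hspan, Submodule.map_span, Finset.coe_image]
  · rw [Finset.filter_image]
    exact Finset.card_image_le.trans (htwo (φ f))

end CycleSpace

namespace MonotoneArcSystem

variable {E : Type*} [Fintype E] (S : MonotoneArcSystem E) {M : Type*} [AddCommGroup M]

open scoped Classical in
/-- The boundary modulo 2 of the set of points below which the flux of `χ` is `F`. -/
noncomputable def faceBoundary (χ : E → M) (F : M) : E → ZMod 2 :=
  S.jump χ (Pi.single F 1)

open scoped Classical in
theorem card_faceBoundary_ne_zero_le [Fintype M] (χ : E → M) (e : E) :
    #{F | S.faceBoundary χ F e ≠ 0} ≤ 2 := by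
  refine (Finset.card_le_card (t := {S.fluxBelow χ e, S.fluxBelow χ e + χ e})
    fun F hF => ?_).trans Finset.card_le_two
  rw [Finset.mem_filter] at hF
  contrapose! hF
  simp only [Finset.mem_insert, Finset.mem_singleton, not_or] at hF
  simp [faceBoundary, jump, Ne.symm hF.1, Ne.symm hF.2]

theorem sum_smul_faceBoundary [Fintype M] (χ : E → M) (h : M →+ ZMod 2) :
    ∑ F, h F • S.faceBoundary χ F = h ∘ χ := by
  classical
  ext e
  simp [faceBoundary, jump, Pi.single_apply, mul_sub]

theorem hasTwofoldSpan : HasTwofoldSpan (cycleSpace fun e => s(S.left e, S.right e)) := by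
  classical
  set Z := cycleSpace fun e => s(S.left e, S.right e)
  have mem_Z_iff {C : E → ZMod 2} : C ∈ Z ↔ IsCirculation S.left S.right C :=
    mem_cycleSpace_iff_isCirculation fun e => (S.left_lt_right e).ne
  -- Two points are in the same face if every cycle winds around both with the same parity.
  let χ : E → Z → ZMod 2 := fun e C => C.1 e
  have hχ : IsCirculation S.left S.right χ := fun p => funext fun C => by
    simpa [χ] using mem_Z_iff.1 C.2 p
  have : Fintype Z := Fintype.ofFinite Z
  refine ⟨Finset.univ.image (S.faceBoundary χ), le_antisymm ?_ fun C hC => ?_, fun e => ?_⟩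
  · rw [Submodule.span_le, Finset.coe_image]
    rintro _ ⟨F, -, rfl⟩
    exact mem_Z_iff.2 (S.isCirculation_jump hχ _)
  · have hsum : ∑ F, F ⟨C, hC⟩ • S.faceBoundary χ F = C :=
      S.sum_smul_faceBoundary χ (Pi.evalAddMonoidHom (fun _ : Z => ZMod 2) ⟨C, hC⟩)
    rw [← hsum]
    exact Submodule.sum_mem _ fun F _ => Submodule.smul_mem _ _ (Submodule.subset_span (by simp))
  · rw [Finset.filter_image]
    exact Finset.card_image_le.trans (S.card_faceBoundary_ne_zero_le χ e)

end MonotoneArcSystem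

section Segments

theorem exists_injOn_fst_add_mul_snd {K : Type*} [Field K] [Infinite K] {P : Set (K × K)}
    (hP : P.Finite) : ∃ t : K, P.InjOn fun z => z.1 + t * z.2 := by
  -- The slopes of the lines through two points of `P` are the values of `t` to avoid.
  obtain ⟨t, ht⟩ := ((hP.prod hP).image fun q : (K × K) × (K × K) =>
    (q.2.1 - q.1.1) / (q.1.2 - q.2.2)).infinite_compl.nonempty
  refine ⟨t, fun a ha b hb h => ?_⟩
  simp only at h
  by_cases hsnd : a.2 = b.2
  · exact Prod.ext (by rwa [hsnd, add_left_inj] at h) hsnd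
  · refine absurd ⟨(a, b), ⟨ha, hb⟩, ?_⟩ ht
    rw [div_eq_iff (sub_ne_zero.2 hsnd)]
    linear_combination -h

/-- The second coordinate of the point of the segment from `a` to `b` at which the functional `φ`
takes the value `x`; junk if `φ a = φ b`. -/
noncomputable def segmentHeight (φ : ℝ × ℝ →ₗ[ℝ] ℝ) (a b : ℝ × ℝ) (x : ℝ) : ℝ :=
  AffineMap.lineMap a.2 b.2 ((x - φ a) / (φ b - φ a))

variable {φ : ℝ × ℝ →ₗ[ℝ] ℝ}

section SegmentHeight

variable {a b : ℝ × ℝ}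

theorem continuous_segmentHeight : Continuous (segmentHeight φ a b) :=
  AffineMap.lineMap_continuous.comp (by fun_prop)

theorem segmentHeight_lineMap (hab : φ a ≠ φ b) (c : ℝ) :
    segmentHeight φ a b (φ (AffineMap.lineMap a b c)) = (AffineMap.lineMap a b c).2 := by
  have hc : (φ (AffineMap.lineMap a b c) - φ a) / (φ b - φ a) = c := by
    rw [div_eq_iff (sub_ne_zero.2 hab.symm)]
    simp [AffineMap.lineMap_apply]
  rw [segmentHeight, hc]
  simp [AffineMap.lineMap_apply]

theorem segmentHeight_left (hab : φ a ≠ φ b) : segmentHeight φ a b (φ a) = a.2 := by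
  simpa using segmentHeight_lineMap hab 0

theorem segmentHeight_right (hab : φ a ≠ φ b) : segmentHeight φ a b (φ b) = b.2 := by
  simpa using segmentHeight_lineMap hab 1

theorem exists_mem_segment_of_mem_uIcc (hab : φ a ≠ φ b) {x : ℝ}
    (hx : x ∈ Set.uIcc (φ a) (φ b)) :
    ∃ z ∈ segment ℝ a b, φ z = x ∧ z.2 = segmentHeight φ a b x := by
  have himage : φ '' segment ℝ a b = Set.uIcc (φ a) (φ b) := by
    rw [← segment_eq_uIcc]
    exact image_segment ℝ φ.toAffineMap a b
  rw [← himage, segment_eq_image_lineMap] at hx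
  obtain ⟨_, ⟨c, hc, rfl⟩, rfl⟩ := hx
  refine ⟨_, ?_, rfl, (segmentHeight_lineMap hab c).symm⟩
  rw [segment_eq_image_lineMap]
  exact Set.mem_image_of_mem _ hc

end SegmentHeight

/-- Segments in the plane as a monotone arc system, with the values of the linear functional `φ`
as abscissae. -/
noncomputable def MonotoneArcSystem.ofSegments {E : Type*} {a b : E → ℝ × ℝ}
    (hφ : Set.InjOn φ (Set.range a ∪ Set.range b))
    (hφ_ext : ∀ z z', φ z = φ z' → z.2 = z'.2 → z = z') (hne : ∀ e, φ (a e) ≠ φ (b e))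
    (hmeet : ∀ {e e'}, e ≠ e' → ∀ {z}, z ∈ segment ℝ (a e) (b e) → z ∈ segment ℝ (a e') (b e') →
      z = a e ∨ z = b e) :
    MonotoneArcSystem E :=
  have ordinate_eq {z : ℝ × ℝ} (hz : z ∈ Set.range a ∪ Set.range b) :
      (Function.invFunOn φ (Set.range a ∪ Set.range b) (φ z)).2 = z.2 :=
    congrArg Prod.snd (hφ.leftInvOn_invFunOn hz)
  have height_end (e : E) {x : ℝ} (hx : x = φ (a e) ∨ x = φ (b e)) :
      segmentHeight φ (a e) (b e) x =
        (Function.invFunOn φ (Set.range a ∪ Set.range b) x).2 := by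
    rcases hx with rfl | rfl
    · rw [ordinate_eq (.inl ⟨e, rfl⟩), segmentHeight_left (hne e)]
    · rw [ordinate_eq (.inr ⟨e, rfl⟩), segmentHeight_right (hne e)]
  { left e := min (φ (a e)) (φ (b e))
    right e := max (φ (a e)) (φ (b e))
    height e := segmentHeight φ (a e) (b e)
    ordinate x := (Function.invFunOn φ (Set.range a ∪ Set.range b) x).2
    left_lt_right e := min_lt_max.2 (hne e)
    continuousOn_height e := continuous_segmentHeight.continuousOn
    height_left e := height_end e (min_choice _ _)
    height_right e := height_end e (max_choice _ _)
    eq_end_of_height_eq {e e'} hee' x hx hx' h := by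
      obtain ⟨z, hz, rfl, hsnd⟩ := exists_mem_segment_of_mem_uIcc (hne e) hx
      obtain ⟨z', hz', hφz, hsnd'⟩ := exists_mem_segment_of_mem_uIcc (hne e') hx'
      obtain rfl : z' = z := hφ_ext _ _ hφz (hsnd'.trans (h.symm.trans hsnd.symm))
      rcases hmeet hee' hz hz' with rfl | rfl <;> grind }

theorem hasTwofoldSpan_of_segments {E : Type*} [Fintype E] {a b : E → ℝ × ℝ}
    (hne : ∀ e, a e ≠ b e)
    (hmeet : ∀ {e e'}, e ≠ e' → ∀ {z}, z ∈ segment ℝ (a e) (b e) → z ∈ segment ℝ (a e') (b e') →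
      z = a e ∨ z = b e) :
    HasTwofoldSpan (cycleSpace fun e => s(a e, b e)) := by
  obtain ⟨t, ht⟩ := exists_injOn_fst_add_mul_snd ((Set.finite_range a).union (Set.finite_range b))
  let φ : ℝ × ℝ →ₗ[ℝ] ℝ := LinearMap.fst ℝ ℝ ℝ + t • LinearMap.snd ℝ ℝ ℝ
  have hφ : Set.InjOn φ (Set.range a ∪ Set.range b) := ht
  have hφ_ext (z z' : ℝ × ℝ) (h : φ z = φ z') (hsnd : z.2 = z'.2) : z = z' :=
    Prod.ext (by simpa [φ, hsnd] using h) hsnd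
  have hφ_ne (e : E) : φ (a e) ≠ φ (b e) := fun h =>
    hne e (hφ (.inl ⟨e, rfl⟩) (.inr ⟨e, rfl⟩) h)
  have hends : {p | ∃ e, p ∈ s(a e, b e)} ⊆ Set.range a ∪ Set.range b := by
    rintro p ⟨e, he⟩
    rcases Sym2.mem_iff.1 he with rfl | rfl
    · exact .inl ⟨e, rfl⟩
    · exact .inr ⟨e, rfl⟩
  let S := MonotoneArcSystem.ofSegments hφ hφ_ext hφ_ne hmeet
  have map_ends (e : E) : s(a e, b e).map φ = s(S.left e, S.right e) := by
    rw [Sym2.map_mk]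
    rcases le_total (φ (a e)) (φ (b e)) with h | h
    · simp [S, MonotoneArcSystem.ofSegments, h]
    · simp [S, MonotoneArcSystem.ofSegments, h, Sym2.eq_swap]
  rw [← cycleSpace_map (hφ.mono hends), funext map_ends]
  exact S.hasTwofoldSpan

end Segments

section Subdivision

variable {E P M : Type*}

/-- The paths `p e 0, …, p e (n e)` form a subdivision of the multigraph whose edge `e` joins
`p e 0` to `p e (n e)`: they meet one another at most in their ends. -/
structure IsSubdivision (n : E → ℕ) (p : E → ℕ → P) : Prop where
  pos : ∀ e, 0 < n e
  ends_ne : ∀ e, p e 0 ≠ p e (n e)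
  inner_unique : ∀ {e i}, 0 < i → i < n e → ∀ {e' j}, j ≤ n e' → p e' j = p e i → e' = e ∧ j = i

theorem isCirculation_pieces_iff [Fintype E] [AddCommGroup M] (n : E → ℕ) (p : E → ℕ → P)
    (D : E → M) :
    IsCirculation (fun x : Σ e, Fin (n e) => p x.1 x.2) (fun x => p x.1 (x.2 + 1))
      (fun x => D x.1) ↔ IsCirculation (p · 0) (fun e => p e (n e)) D := by
  classical
  refine forall_congr' fun q => ?_
  have telescope (e : E) :
      ∑ i : Fin (n e), ((if p e i = q then D e else 0) - if p e (i + 1) = q then D e else 0) =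
        (if p e 0 = q then D e else 0) - if p e (n e) = q then D e else 0 := by
    rw [Fin.sum_univ_eq_sum_range fun i =>
      (if p e i = q then D e else 0) - if p e (i + 1) = q then D e else 0]
    exact Finset.sum_range_sub' (fun i => if p e i = q then D e else 0) (n e)
  simp only [Finset.sum_filter]
  rw [← sub_eq_zero, ← sub_eq_zero (b := ∑ e, _), ← Finset.sum_sub_distrib,
    ← Finset.sum_sub_distrib, Fintype.sum_sigma]
  simp only [telescope]

namespace IsSubdivision

variable {n : E → ℕ} {p : E → ℕ → P}

theorem piece_ne (h : IsSubdivision n p) (x : Σ e, Fin (n e)) : p x.1 x.2 ≠ p x.1 (x.2 + 1) := by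
  obtain ⟨e, i, hi⟩ := x
  intro heq
  rcases (Nat.succ_le_of_lt hi).lt_or_eq with hlt | hlast
  · have := (h.inner_unique i.succ_pos hlt hi.le heq).2
    omega
  · rcases i.eq_zero_or_pos with rfl | hpos
    · exact h.ends_ne e (hlast ▸ heq)
    · have := (h.inner_unique hpos hi hi heq.symm).2
      omega

theorem eq_first_of_isCirculation [Fintype E] [AddCommMonoid M] (h : IsSubdivision n p)
    {C : (Σ e, Fin (n e)) → M}
    (hC : IsCirculation (fun x => p x.1 x.2) (fun x => p x.1 (x.2 + 1)) C) (e : E)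
    (i : Fin (n e)) : C ⟨e, i⟩ = C ⟨e, ⟨0, h.pos e⟩⟩ := by
  classical
  obtain ⟨i, hi⟩ := i
  induction i with
  | zero => rfl
  | succ i ih =>
    have hstart : ({x | p x.1 x.2 = p e (i + 1)} : Finset (Σ e, Fin (n e))) = {⟨e, i + 1, hi⟩} := by
      ext ⟨e', j⟩
      simp only [Finset.mem_filter, Finset.mem_univ, true_and, Finset.mem_singleton]
      refine ⟨fun heq => ?_, fun heq => by cases heq; rfl⟩
      obtain ⟨rfl, hj⟩ := h.inner_unique i.succ_pos hi j.2.le heq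
      exact congrArg _ (Fin.ext hj)
    have hend : ({x | p x.1 (x.2 + 1) = p e (i + 1)} : Finset (Σ e, Fin (n e))) =
        {⟨e, i, by omega⟩} := by
      ext ⟨e', j⟩
      simp only [Finset.mem_filter, Finset.mem_univ, true_and, Finset.mem_singleton]
      refine ⟨fun heq => ?_, fun heq => by cases heq; rfl⟩
      obtain ⟨rfl, hj⟩ := h.inner_unique i.succ_pos hi (Nat.succ_le_of_lt j.2) heq
      exact congrArg _ (Fin.ext (Nat.succ_injective hj))
    have hflow := hC (p e (i + 1))
    rw [hstart, hend, Finset.sum_singleton, Finset.sum_singleton] at hflow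
    exact hflow.trans (ih _)

theorem map_cycleSpace_pieces [Fintype E] (h : IsSubdivision n p) :
    (cycleSpace fun x : Σ e, Fin (n e) => s(p x.1 x.2, p x.1 (x.2 + 1))).map
      (LinearMap.funLeft (ZMod 2) (ZMod 2) fun e => ⟨e, ⟨0, h.pos e⟩⟩) =
      cycleSpace fun e => s(p e 0, p e (n e)) := by
  ext D
  rw [mem_cycleSpace_iff_isCirculation h.ends_ne, ← isCirculation_pieces_iff]
  constructor
  · rintro ⟨C, hC, rfl⟩
    rw [SetLike.mem_coe, mem_cycleSpace_iff_isCirculation h.piece_ne] at hC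
    have hconst : (fun x : Σ e, Fin (n e) => C ⟨x.1, ⟨0, h.pos x.1⟩⟩) = C :=
      funext fun x => (h.eq_first_of_isCirculation hC x.1 x.2).symm
    exact hconst.symm ▸ hC
  · exact fun hD => ⟨fun x => D x.1, (mem_cycleSpace_iff_isCirculation h.piece_ne).2 hD, rfl⟩

theorem hasTwofoldSpan [Fintype E] (h : IsSubdivision n p)
    (hpieces : HasTwofoldSpan
      (cycleSpace fun x : Σ e, Fin (n e) => s(p x.1 x.2, p x.1 (x.2 + 1)))) :
    HasTwofoldSpan (cycleSpace fun e => s(p e 0, p e (n e))) :=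
  h.map_cycleSpace_pieces ▸ hpieces.map_funLeft _

end IsSubdivision

end Subdivision

section Chain

variable {F : Type*} [AddCommGroup F] [Module ℝ F]

/-- The corners `p 0, …, p n` of a polygonal chain that does not meet itself: the condition on the
corners in `SimpleGraph.IsPolygonalArc`. -/
structure IsSimpleChain (n : ℕ) (p : ℕ → F) : Prop where
  injOn : Set.InjOn p (Set.Iic n)
  inter_succ : ∀ i, i + 1 < n →
    segment ℝ (p i) (p (i + 1)) ∩ segment ℝ (p (i + 1)) (p (i + 2)) = {p (i + 1)}
  disjoint : ∀ i j, i + 1 < j → j < n →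
    Disjoint (segment ℝ (p i) (p (i + 1))) (segment ℝ (p j) (p (j + 1)))

namespace IsSimpleChain

variable {n : ℕ} {p : ℕ → F} {i j k : ℕ} {z : F}

theorem eq_end_of_mem_segment (h : IsSimpleChain n p) (hi : i < n) (hj : j < n) (hij : i ≠ j)
    (hz : z ∈ segment ℝ (p i) (p (i + 1))) (hz' : z ∈ segment ℝ (p j) (p (j + 1))) :
    z = p i ∨ z = p (i + 1) := by
  rcases hij.lt_or_gt with hlt | hlt
  · rcases (Nat.succ_le_of_lt hlt).lt_or_eq with hlt | rfl
    · exact absurd hz' (Set.disjoint_left.1 (h.disjoint i j hlt hj) hz)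
    · exact .inr ((h.inter_succ i hj).subset ⟨hz, hz'⟩)
  · rcases (Nat.succ_le_of_lt hlt).lt_or_eq with hlt | rfl
    · exact absurd hz (Set.disjoint_left.1 (h.disjoint j i hlt hi) hz')
    · exact .inl ((h.inter_succ j hi).subset ⟨hz', hz⟩)

theorem index_eq_of_mem_segment (h : IsSimpleChain n p) (hi : i < n) (hk : k ≤ n)
    (hmem : p k ∈ segment ℝ (p i) (p (i + 1))) : k = i ∨ k = i + 1 := by
  obtain ⟨j, hj, hkj, hmem'⟩ :
      ∃ j < n, (k = j ∨ k = j + 1) ∧ p k ∈ segment ℝ (p j) (p (j + 1)) := by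
    rcases hk.lt_or_eq with hk | rfl
    · exact ⟨k, hk, .inl rfl, left_mem_segment ℝ _ _⟩
    · obtain ⟨m, rfl⟩ := Nat.exists_eq_succ_of_ne_zero (Nat.ne_zero_of_lt hi)
      exact ⟨m, m.lt_succ_self, .inr rfl, right_mem_segment ℝ _ _⟩
  by_cases hij : i = j
  · rwa [hij]
  · exact (h.eq_end_of_mem_segment hi hj hij hmem hmem').imp (h.injOn hk hi.le) (h.injOn hk hi)

theorem zero_ne_last (h : IsSimpleChain n p) (hn : 0 < n) : p 0 ≠ p n := fun heq =>
  hn.ne (h.injOn (Nat.zero_le n) Set.self_mem_Iic heq)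

end IsSimpleChain

/-- The points of the polygonal chain with corners `p 0, …, p n`. -/
def chainCarrier (n : ℕ) (p : ℕ → F) : Set F :=
  ⋃ i ∈ Set.Iio n, segment ℝ (p i) (p (i + 1))

theorem segment_subset_chainCarrier {n : ℕ} {p : ℕ → F} {i : ℕ} (hi : i < n) :
    segment ℝ (p i) (p (i + 1)) ⊆ chainCarrier n p :=
  Set.subset_biUnion_of_mem (u := fun i => segment ℝ (p i) (p (i + 1))) hi

theorem corner_mem_chainCarrier {n : ℕ} {p : ℕ → F} (hn : 0 < n) {j : ℕ} (hj : j ≤ n) :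
    p j ∈ chainCarrier n p := by
  rcases hj.lt_or_eq with hj | rfl
  · exact segment_subset_chainCarrier hj (left_mem_segment ℝ _ _)
  · obtain ⟨m, rfl⟩ := Nat.exists_eq_succ_of_ne_zero hn.ne'
    exact segment_subset_chainCarrier m.lt_succ_self (right_mem_segment ℝ _ _)

/-- The polygonal chains with corners `p e 0, …, p e (n e)` do not meet themselves and meet one
another only in ends of both chains. -/
structure IsChainSystem {E : Type*} (n : E → ℕ) (p : E → ℕ → F) : Prop where
  pos : ∀ e, 0 < n e
  isSimpleChain : ∀ e, IsSimpleChain (n e) (p e)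
  eq_end : ∀ {e e'}, e ≠ e' → ∀ {z}, z ∈ chainCarrier (n e) (p e) →
    z ∈ chainCarrier (n e') (p e') → z = p e 0 ∨ z = p e (n e)

namespace IsChainSystem

variable {E : Type*} {n : E → ℕ}

theorem isSubdivision {p : E → ℕ → F} (h : IsChainSystem n p) : IsSubdivision n p where
  pos := h.pos
  ends_ne e := (h.isSimpleChain e).zero_ne_last (h.pos e)
  inner_unique {e i} hi0 hin {e' j} hj hji := by
    have corner_inj {k} (hk : k ≤ n e) (heq : p e i = p e k) : i = k :=
      (h.isSimpleChain e).injOn hin.le hk heq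
    obtain rfl : e' = e := by
      by_contra hne
      rcases h.eq_end (Ne.symm hne) (corner_mem_chainCarrier (h.pos e) hin.le)
        (hji ▸ corner_mem_chainCarrier (h.pos e') hj) with heq | heq
      · exact hi0.ne' (corner_inj (Nat.zero_le _) heq)
      · exact hin.ne (corner_inj le_rfl heq)
    exact ⟨rfl, (corner_inj hj hji.symm).symm⟩

theorem eq_end_of_mem_segment {p : E → ℕ → F} (h : IsChainSystem n p) {x y : Σ e, Fin (n e)}
    (hxy : x ≠ y) {z : F} (hz : z ∈ segment ℝ (p x.1 x.2) (p x.1 (x.2 + 1)))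
    (hz' : z ∈ segment ℝ (p y.1 y.2) (p y.1 (y.2 + 1))) :
    z = p x.1 x.2 ∨ z = p x.1 (x.2 + 1) := by
  obtain ⟨e, i⟩ := x
  obtain ⟨e', j⟩ := y
  by_cases he : e = e'
  · subst he
    exact (h.isSimpleChain e).eq_end_of_mem_segment i.2 j.2
      (fun hij => hxy (congrArg _ (Fin.ext hij))) hz hz'
  · have corner_eq {k} (hk : k ≤ n e) (hmem : p e k ∈ segment ℝ (p e i) (p e (i + 1))) :
        p e k = p e i ∨ p e k = p e (i + 1) :=
      ((h.isSimpleChain e).index_eq_of_mem_segment i.2 hk hmem).imp (congrArg _) (congrArg _)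
    rcases h.eq_end he (segment_subset_chainCarrier i.2 hz)
      (segment_subset_chainCarrier j.2 hz') with rfl | rfl
    · exact corner_eq (Nat.zero_le _) hz
    · exact corner_eq le_rfl hz

theorem hasTwofoldSpan [Fintype E] {p : E → ℕ → ℝ × ℝ} (h : IsChainSystem n p) :
    HasTwofoldSpan (cycleSpace fun e => s(p e 0, p e (n e))) :=
  h.isSubdivision.hasTwofoldSpan
    (hasTwofoldSpan_of_segments h.isSubdivision.piece_ne h.eq_end_of_mem_segment)

end IsChainSystem

end Chain

section PlaneDrawing

variable {V : Type*} {G : SimpleGraph V}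

theorem exists_isSimpleChain_of_planeDrawing (D : G.PlaneDrawing) (e : G.edgeSet) :
    ∃ (n : ℕ) (p : ℕ → ℝ × ℝ), 0 < n ∧ (e : Sym2 V).map D.point = s(p 0, p n) ∧
      IsSimpleChain n p ∧ D.arc e = chainCarrier n p := by
  obtain ⟨e, he⟩ := e
  induction e with | _ u v =>
  obtain ⟨n, p, hn, h0, hlast, hinj, hsucc, hdisj, harc⟩ := D.isPolygonalArc u v he
  exact ⟨n, p, hn, by simp [h0, hlast], ⟨hinj, hsucc, hdisj⟩, harc⟩

theorem hasTwofoldSpan_cycleSpace_of_isPlanar [Fintype G.edgeSet] (hG : G.IsPlanar) :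
    HasTwofoldSpan (cycleSpace ((↑) : G.edgeSet → Sym2 V)) := by
  obtain ⟨D⟩ := hG
  choose n p hn hends hchain harc using exists_isSimpleChain_of_planeDrawing D
  have hsystem : IsChainSystem n p :=
    { pos := hn
      isSimpleChain := hchain
      eq_end := fun {e e'} hne z hz hz' => by
        rw [← harc] at hz hz'
        obtain ⟨v, hv, -, rfl⟩ := D.inter_subset e e' hne z ⟨hz, hz'⟩
        rw [← Sym2.mem_iff, ← hends]
        exact Sym2.mem_map.2 ⟨v, hv, rfl⟩ }
  have hspan := hsystem.hasTwofoldSpan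
  simp only [← hends] at hspan
  rwa [cycleSpace_map D.point_injective.injOn] at hspan

end PlaneDrawing

/-! ### Euler's inequality -/

section Euler

theorem sum_zmod_two_eq_card {ι : Type*} (B : Finset ι) (f : ι → ZMod 2) :
    ∑ b ∈ B, f b = #{b ∈ B | f b ≠ 0} := by
  have eq_ite : ∀ a : ZMod 2, a = if a ≠ 0 then 1 else 0 := by decide
  rw [Finset.card_filter, Nat.cast_sum]
  exact Finset.sum_congr rfl fun b _ => by simpa using eq_ite (f b)

theorem card_ne_zero_add_ite_sum_ne_zero_le {ι : Type*} {B : Finset ι} {f : ι → ZMod 2}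
    (hf : #{b ∈ B | f b ≠ 0} ≤ 2) :
    #{b ∈ B | f b ≠ 0} + (if ∑ b ∈ B, f b ≠ 0 then 1 else 0) ≤ 2 := by
  rw [sum_zmod_two_eq_card]
  generalize #{b ∈ B | f b ≠ 0} = t at hf
  interval_cases t <;> decide

variable {E : Type*}

theorem HasTwofoldSpan.exists_linearIndepOn {Z : Submodule (ZMod 2) (E → ZMod 2)}
    (hZ : HasTwofoldSpan Z) :
    ∃ B : Finset (E → ZMod 2), LinearIndepOn (ZMod 2) id (B : Set (E → ZMod 2)) ∧
      Submodule.span (ZMod 2) (B : Set (E → ZMod 2)) = Z ∧ ∀ e, #{b ∈ B | b e ≠ 0} ≤ 2 := by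
  obtain ⟨B, hspan, htwo⟩ := hZ
  obtain ⟨B', hB', hspan', hind⟩ :=
    exists_linearIndependent (ZMod 2) (B : Set (E → ZMod 2))
  lift B' to Finset (E → ZMod 2) using B.finite_toSet.subset hB'
  refine ⟨B', hind, hspan'.trans hspan, fun e => (Finset.card_le_card ?_).trans (htwo e)⟩
  exact Finset.filter_subset_filter _ (Finset.coe_subset.1 hB')

theorem HasTwofoldSpan.finrank_add_one_mul_le [Fintype E]
    {Z : Submodule (ZMod 2) (E → ZMod 2)} (hZ : HasTwofoldSpan Z) (hbot : Z ≠ ⊥) {g : ℕ}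
    (hg : ∀ C ∈ Z, C ≠ 0 → g ≤ #{e | C e ≠ 0}) :
    (Module.finrank (ZMod 2) Z + 1) * g ≤ 2 * Fintype.card E := by
  obtain ⟨B, hind, rfl, htwo⟩ := hZ.exists_linearIndepOn
  have hmem {b} (hb : b ∈ B) : b ∈ Submodule.span (ZMod 2) (B : Set (E → ZMod 2)) :=
    Submodule.subset_span hb
  have hne {b} (hb : b ∈ B) : b ≠ 0 := hind.ne_zero hb
  have hsum_ne : ∑ b ∈ B, b ≠ 0 := by
    intro hsum
    have hB : B.Nonempty := by
      rw [Finset.nonempty_iff_ne_empty]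
      rintro rfl
      simp at hbot
    obtain ⟨b, hb⟩ := hB
    exact one_ne_zero (linearIndepOn_finset_iff.1 hind (fun _ => 1) (by simpa using hsum) b hb)
  -- Like the outer face of a drawing, the sum of the basis is one more member that can be added.
  calc (Module.finrank (ZMod 2) (Submodule.span (ZMod 2) (B : Set (E → ZMod 2))) + 1) * g
      = ∑ _b ∈ B, g + g := by
        rw [finrank_span_finset_eq_card hind, Finset.sum_const, smul_eq_mul, add_one_mul]
    _ ≤ ∑ b ∈ B, #{e | b e ≠ 0} + #{e | (∑ b ∈ B, b) e ≠ 0} :=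
        add_le_add (Finset.sum_le_sum fun b hb => hg b (hmem hb) (hne hb))
          (hg _ (Submodule.sum_mem _ fun b hb => hmem hb) hsum_ne)
    _ = ∑ e, (#{b ∈ B | b e ≠ 0} + if ∑ b ∈ B, b e ≠ 0 then 1 else 0) := by
        simp only [Finset.sum_add_distrib, Finset.card_filter, Finset.sum_apply]
        rw [Finset.sum_comm]
    _ ≤ ∑ _e : E, 2 := Finset.sum_le_sum fun e _ => card_ne_zero_add_ite_sum_ne_zero_le (htwo e)
    _ = 2 * Fintype.card E := by rw [Finset.sum_const, Finset.card_univ, smul_eq_mul, mul_comm]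

theorem card_add_one_le_finrank_ker_mulVecLin_add_card {K P : Type*} [Field K] [Fintype E]
    [Fintype P] [Nonempty P] (A : Matrix P E K) (hA : ∀ e, ∑ p, A p e = 0) :
    Fintype.card E + 1 ≤ Module.finrank K A.mulVecLin.ker + Fintype.card P := by
  classical
  have hsum (C : E → K) : ∑ p, A.mulVecLin C p = 0 := by
    simp only [Matrix.mulVecLin_apply, Matrix.mulVec, dotProduct]
    rw [Finset.sum_comm]
    simp only [← Finset.sum_mul, hA, zero_mul, Finset.sum_const_zero]
  have hrange : A.mulVecLin.range ≠ ⊤ := by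
    intro htop
    obtain ⟨p⟩ := ‹Nonempty P›
    obtain ⟨C, hC⟩ : Pi.single p 1 ∈ A.mulVecLin.range := htop ▸ Submodule.mem_top
    simpa [hC] using hsum C
  have hlt := Submodule.finrank_lt hrange
  have hrank := A.mulVecLin.finrank_range_add_finrank_ker
  rw [Module.finrank_fintype_fun_eq_card] at hlt hrank
  omega

theorem card_add_one_le_finrank_cycleSpace_add_card [Fintype E] {P : Type*} {ends : E → Sym2 P}
    (hends : ∀ e, ¬(ends e).IsDiag) {s : Finset P} (hs : s.Nonempty)
    (hmem : ∀ e, ∀ p ∈ ends e, p ∈ s) :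
    Fintype.card E + 1 ≤ Module.finrank (ZMod 2) (cycleSpace ends) + #s := by
  classical
  let A : Matrix s E (ZMod 2) := fun p e => if p.1 ∈ ends e then 1 else 0
  have hker : A.mulVecLin.ker = cycleSpace ends := by
    ext C
    have mulVec_apply (p : s) : A.mulVecLin C p = ∑ e with p.1 ∈ ends e, C e := by
      rw [Finset.sum_filter]
      exact Finset.sum_congr rfl fun e _ => boole_mul _ _
    rw [LinearMap.mem_ker, funext_iff, mem_cycleSpace]
    refine ⟨fun h p => ?_, fun h p => (mulVec_apply p).trans (h p)⟩
    by_cases hp : p ∈ s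
    · exact (mulVec_apply ⟨p, hp⟩).symm.trans (h ⟨p, hp⟩)
    · exact Finset.sum_eq_zero fun e he => absurd (hmem e p (Finset.mem_filter.1 he).2) hp
  have hA (e : E) : ∑ p, A p e = 0 := by
    have hfilter : {p ∈ s | p ∈ ends e} = (ends e).toFinset := by
      ext p
      simpa using hmem e p
    calc ∑ p, A p e = ∑ p ∈ s, if p ∈ ends e then 1 else 0 :=
          Finset.sum_coe_sort s fun p => if p ∈ ends e then (1 : ZMod 2) else 0
      _ = #{p ∈ s | p ∈ ends e} := (Finset.natCast_card_filter _ _).symm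
      _ = 0 := by
        rw [hfilter, Sym2.card_toFinset_of_not_isDiag _ (hends e)]
        exact CharTwo.two_eq_zero
  have : Nonempty s := hs.to_subtype
  have hrank := card_add_one_le_finrank_ker_mulVecLin_add_card A hA
  rwa [hker, Fintype.card_coe] at hrank

end Euler

section Girth

variable {V : Type*} {G : SimpleGraph V}

theorem egirth_le_encard_edgeSet (hG : ¬G.IsAcyclic) : G.egirth ≤ G.edgeSet.encard := by
  classical
  obtain ⟨a, w, hw, hlen⟩ := SimpleGraph.exists_egirth_eq_length.2 hG
  rw [hlen, ← w.length_edges, ← List.toFinset_card_of_nodup hw.isTrail.edges_nodup,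
    ← Set.encard_coe_eq_coe_finsetCard]
  exact Set.encard_le_encard fun e he => w.edges_subset_edgeSet (List.mem_toFinset.1 he)

theorem fromEdgeSet_image_coe_adj {S : Set G.edgeSet} {x y : V} :
    (SimpleGraph.fromEdgeSet ((↑) '' S)).Adj x y ↔ ∃ h : G.Adj x y, ⟨s(x, y), h⟩ ∈ S := by
  rw [SimpleGraph.fromEdgeSet_adj]
  constructor
  · rintro ⟨⟨⟨e, he⟩, heS, rfl⟩, -⟩
    exact ⟨he, heS⟩
  · rintro ⟨h, hS⟩
    exact ⟨⟨_, hS, rfl⟩, h.ne⟩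

theorem fromEdgeSet_image_coe_le (S : Set G.edgeSet) :
    SimpleGraph.fromEdgeSet ((↑) '' S) ≤ G := fun _ _ h => (fromEdgeSet_image_coe_adj.1 h).1

variable [Fintype G.edgeSet] {C : G.edgeSet → ZMod 2}

theorem apply_eq_zero_of_mem_cycleSpace_of_cut (hC : C ∈ cycleSpace ((↑) : G.edgeSet → Sym2 V))
    {K : Finset V} {a b : V} (hab : G.Adj a b) (ha : a ∈ K) (hb : b ∉ K)
    (hcut : ∀ x y, ∀ hxy : G.Adj x y, s(x, y) ≠ s(a, b) → C ⟨s(x, y), hxy⟩ ≠ 0 →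
      (x ∈ K ↔ y ∈ K)) :
    C ⟨s(a, b), hab⟩ = 0 := by
  classical
  have card_ends {x y : V} (hxy : G.Adj x y) : (#{v ∈ K | v ∈ s(x, y)} : ZMod 2) =
      (if x ∈ K then 1 else 0) + if y ∈ K then 1 else 0 := by
    have ite_mem (v : V) : (if v ∈ s(x, y) then 1 else 0 : ZMod 2) =
        (if v = x then 1 else 0) + if v = y then 1 else 0 := by
      have := hxy.ne
      grind
    simp only [Finset.natCast_card_filter, ite_mem, Finset.sum_add_distrib, Finset.sum_ite_eq']
  have hsum := sum_card_ends_mem_mul_eq_zero hC K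
  rw [Finset.sum_eq_single (⟨s(a, b), hab⟩ : G.edgeSet) ?_ (by simp)] at hsum
  · rwa [card_ends hab, if_pos ha, if_neg hb, add_zero, one_mul] at hsum
  · rintro ⟨e, he⟩ - hne
    induction e with | _ x y =>
    by_cases hCe : C ⟨s(x, y), he⟩ = 0
    · rw [hCe, mul_zero]
    · rw [card_ends he, if_congr (hcut x y he (fun h => hne (Subtype.ext h)) hCe) rfl rfl,
        CharTwo.add_self_eq_zero, zero_mul]

theorem not_isAcyclic_fromEdgeSet_support [Finite V]
    (hC : C ∈ cycleSpace ((↑) : G.edgeSet → Sym2 V)) (hne : C ≠ 0) :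
    ¬(SimpleGraph.fromEdgeSet ((↑) '' Function.support C : Set (Sym2 V))).IsAcyclic := by
  classical
  have := Fintype.ofFinite V
  set H := SimpleGraph.fromEdgeSet ((↑) '' Function.support C : Set (Sym2 V))
  have adj_H {x y : V} (hxy : G.Adj x y) (h : C ⟨s(x, y), hxy⟩ ≠ 0) : H.Adj x y :=
    fromEdgeSet_image_coe_adj.2 ⟨hxy, h⟩
  intro hH
  obtain ⟨⟨e, hab⟩, he⟩ := Function.ne_iff.1 hne
  induction e with | _ a b =>
  have hbridge := SimpleGraph.isBridge_iff.1
    (SimpleGraph.isAcyclic_iff_forall_adj_isBridge.1 hH (adj_H hab he))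
  refine he (apply_eq_zero_of_mem_cycleSpace_of_cut hC
    (K := {v | (H.deleteEdges {s(a, b)}).Reachable a v}) hab (by simp) (by simpa using hbridge)
    fun x y hxy hne hCe => ?_)
  have hadj : (H.deleteEdges {s(a, b)}).Adj x y :=
    SimpleGraph.deleteEdges_adj.2 ⟨adj_H hxy hCe, hne⟩
  simp only [Finset.mem_filter, Finset.mem_univ, true_and]
  exact ⟨fun h => h.trans hadj.reachable, fun h => h.trans hadj.symm.reachable⟩

theorem egirth_le_card_support_of_mem_cycleSpace [Finite V]
    (hC : C ∈ cycleSpace ((↑) : G.edgeSet → Sym2 V)) (hne : C ≠ 0) :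
    G.egirth ≤ #{e | C e ≠ 0} := by
  set S : Set (Sym2 V) := (↑) '' Function.support C
  calc G.egirth
      ≤ (SimpleGraph.fromEdgeSet S).egirth := SimpleGraph.egirth_anti (fromEdgeSet_image_coe_le _)
    _ ≤ (SimpleGraph.fromEdgeSet S).edgeSet.encard :=
        egirth_le_encard_edgeSet (not_isAcyclic_fromEdgeSet_support hC hne)
    _ ≤ S.encard := Set.encard_le_encard (by simp [SimpleGraph.edgeSet_fromEdgeSet])
    _ ≤ (Function.support C).encard := Set.encard_image_le _ _
    _ = #{e | C e ≠ 0} := by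
        rw [← Set.encard_coe_eq_coe_finsetCard]
        congr 1
        ext e
        simp

theorem card_edgeSet_add_two_mul_le_of_isPlanar [Finite V] (hG : G.IsPlanar) {g : ℕ}
    (hg : g ≤ G.egirth) {s : Finset V} (hs : s.Nonempty)
    (hmem : ∀ e ∈ G.edgeSet, ∀ v ∈ e, v ∈ s) (hcard : #s ≤ Fintype.card G.edgeSet) :
    (Fintype.card G.edgeSet + 2) * g ≤ 2 * Fintype.card G.edgeSet + #s * g := by
  set Z := cycleSpace ((↑) : G.edgeSet → Sym2 V)
  have hrank : Fintype.card G.edgeSet + 1 ≤ Module.finrank (ZMod 2) Z + #s :=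
    card_add_one_le_finrank_cycleSpace_add_card (fun e => G.not_isDiag_of_mem_edgeSet e.2) hs
      fun e => hmem e e.2
  have hbot : Z ≠ ⊥ := by
    intro h
    rw [h, finrank_bot] at hrank
    omega
  have hfaces : (Module.finrank (ZMod 2) Z + 1) * g ≤ 2 * Fintype.card G.edgeSet :=
    (hasTwofoldSpan_cycleSpace_of_isPlanar hG).finrank_add_one_mul_le hbot fun C hC hne =>
      Nat.cast_le.1 (hg.trans (egirth_le_card_support_of_mem_cycleSpace hC hne))
  calc (Fintype.card G.edgeSet + 2) * g
      ≤ (Module.finrank (ZMod 2) Z + 1 + #s) * g := Nat.mul_le_mul_right _ (by omega)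
    _ = (Module.finrank (ZMod 2) Z + 1) * g + #s * g := add_mul _ _ _
    _ ≤ 2 * Fintype.card G.edgeSet + #s * g := Nat.add_le_add_right hfaces _

end Girth

theorem isPlanar_of_le {V : Type*} {G H : SimpleGraph V} (hHG : H ≤ G) (hG : G.IsPlanar) :
    H.IsPlanar := by
  obtain ⟨D⟩ := hG
  let ι : H.edgeSet → G.edgeSet := Set.inclusion (SimpleGraph.edgeSet_mono hHG)
  exact ⟨{
    point := D.point
    point_injective := D.point_injective
    arc := fun e => D.arc (ι e)
    isPolygonalArc := fun u v huv => D.isPolygonalArc u v (hHG huv)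
    mem_of_point_mem := fun e v hv => D.mem_of_point_mem (ι e) v hv
    inter_subset := fun e e' hne q hq =>
      D.inter_subset (ι e) (ι e') ((Set.inclusion_injective _).ne hne) q hq }⟩

/-! ### Light edges -/

section LightEdge

theorem inv_add_inv_le_of_add_two_le {a b k : ℕ} (ha : a ≤ k) (hb : b ≤ k)
    (hab : k + 2 ≤ a + b) : (a : ℚ)⁻¹ + (b : ℚ)⁻¹ ≤ (k + 2) / (2 * k) := by
  have ha2 : (2 : ℚ) ≤ a := by exact_mod_cast (by omega : 2 ≤ a)
  have hb2 : (2 : ℚ) ≤ b := by exact_mod_cast (by omega : 2 ≤ b)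
  have hk : (0 : ℚ) < k := by exact_mod_cast (by omega : 0 < k)
  have hbk : (b : ℚ) ≤ k := by exact_mod_cast hb
  have hab' : (k + 2 : ℚ) ≤ a + b := by exact_mod_cast hab
  rw [inv_add_inv (by positivity) (by positivity), div_le_div_iff₀ (by positivity)
    (by positivity)]
  -- The bound is linear in `a` and follows from its case `a = k + 2 - b`, i.e. from `hprod`.
  have hprod : 0 ≤ (k + 2 : ℚ) * ((b - 2) * (k - b)) :=
    mul_nonneg (by positivity) (mul_nonneg (by linarith) (by linarith))
  have hslope : 0 ≤ ((k + 2) * b - 2 * k : ℚ) * (a + b - (k + 2)) :=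
    mul_nonneg (by nlinarith) (by linarith)
  linarith

variable {V : Type*} [Fintype V] {H : SimpleGraph V} [DecidableRel H.Adj]

theorem sum_dart_inv_degree_fst :
    ∑ a : H.Dart, (H.degree a.fst : ℚ)⁻¹ = #{v | 0 < H.degree v} := by
  classical
  calc ∑ a : H.Dart, (H.degree a.fst : ℚ)⁻¹
      = ∑ v, ∑ a : H.Dart with a.fst = v, (H.degree v : ℚ)⁻¹ := by
        rw [← Finset.sum_fiberwise _ (fun a : H.Dart => a.fst)]
        exact Finset.sum_congr rfl fun v _ => Finset.sum_congr rfl fun a ha => by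
          rw [(Finset.mem_filter.1 ha).2]
    _ = ∑ v, if 0 < H.degree v then (1 : ℚ) else 0 := by
        refine Finset.sum_congr rfl fun v _ => ?_
        rw [Finset.sum_const, H.dart_fst_fiber_card_eq_degree, nsmul_eq_mul]
        split_ifs with hv
        · exact mul_inv_cancel₀ (by positivity)
        · simp [Nat.eq_zero_of_not_pos hv]
    _ = #{v | 0 < H.degree v} := (Finset.natCast_card_filter _ _).symm

theorem sum_dart_inv_degree_snd :
    ∑ a : H.Dart, (H.degree a.snd : ℚ)⁻¹ = #{v | 0 < H.degree v} :=
  (Equiv.sum_comp SimpleGraph.Dart.symm_involutive.toPerm fun a : H.Dart =>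
    (H.degree a.fst : ℚ)⁻¹).trans sum_dart_inv_degree_fst

theorem two_mul_card_degree_pos_le {k : ℕ} (hdeg : ∀ v, H.degree v ≤ k)
    (hheavy : ∀ x y, H.Adj x y → k + 2 ≤ H.degree x + H.degree y) :
    2 * k * #{v | 0 < H.degree v} ≤ (k + 2) * #H.edgeFinset := by
  classical
  rcases k.eq_zero_or_pos with rfl | hk
  · simp
  have hdarts : (2 : ℚ) * #{v | 0 < H.degree v} ≤ 2 * #H.edgeFinset * ((k + 2) / (2 * k)) :=
    calc (2 : ℚ) * #{v | 0 < H.degree v}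
        = ∑ a : H.Dart, ((H.degree a.fst : ℚ)⁻¹ + (H.degree a.snd : ℚ)⁻¹) := by
          rw [Finset.sum_add_distrib, sum_dart_inv_degree_fst, sum_dart_inv_degree_snd, two_mul]
      _ ≤ ∑ _a : H.Dart, ((k + 2) / (2 * k) : ℚ) := Finset.sum_le_sum fun a _ =>
          inv_add_inv_le_of_add_two_le (hdeg _) (hdeg _) (hheavy _ _ a.adj)
      _ = 2 * #H.edgeFinset * ((k + 2) / (2 * k)) := by
          rw [Finset.sum_const, Finset.card_univ, H.dart_card_eq_twice_card_edges, nsmul_eq_mul,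
            Nat.cast_mul, Nat.cast_two]
  have hk' : (0 : ℚ) < k := by exact_mod_cast hk
  rw [← mul_div_assoc, le_div_iff₀ (by positivity)] at hdarts
  exact_mod_cast (by linarith : (2 * k * #{v | 0 < H.degree v} : ℚ) ≤ (k + 2) * #H.edgeFinset)

theorem exists_adj_degree_add_degree_le_of_isPlanar (hH : H.IsPlanar) (hne : H ≠ ⊥) {c k : ℕ}
    (hck : 8 ≤ c * (k - 2)) (hg : (4 + c : ℕ) ≤ H.egirth) (hdeg : ∀ v, H.degree v ≤ k) :
    ∃ x y, H.Adj x y ∧ H.degree x + H.degree y ≤ k + 1 := by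
  by_contra! hheavy
  obtain ⟨j, rfl⟩ : ∃ j, k = j + 2 := ⟨k - 2, by grind⟩
  rw [Nat.add_sub_cancel] at hck
  have hcount := two_mul_card_degree_pos_le hdeg hheavy
  have hmem : ∀ e ∈ H.edgeSet, ∀ v ∈ e, v ∈ ({v | 0 < H.degree v} : Finset V) := by
    intro e he v hv
    obtain ⟨w, rfl⟩ := Sym2.mem_iff_exists.1 hv
    exact Finset.mem_filter.2 ⟨Finset.mem_univ v, (H.degree_pos_iff_exists_adj v).2 ⟨w, he⟩⟩
  have hnonempty : ({v | 0 < H.degree v} : Finset V).Nonempty := by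
    obtain ⟨x, y, hxy⟩ := SimpleGraph.ne_bot_iff_exists_adj.1 hne
    exact ⟨x, hmem _ hxy x (Sym2.mem_mk_left x y)⟩
  have hle : #{v | 0 < H.degree v} ≤ #H.edgeFinset := by nlinarith
  rw [SimpleGraph.edgeFinset_card] at hle hcount
  have heuler := card_edgeSet_add_two_mul_le_of_isPlanar hH hg hnonempty hmem hle
  generalize Fintype.card H.edgeSet = m at hcount heuler
  generalize #{v | 0 < H.degree v} = n at hcount heuler
  -- Eliminating `n` leaves `4 * (j + 2) * (4 + c) ≤ (8 - c * j) * m ≤ 0`.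
  have heuler' := Nat.mul_le_mul_left (2 * (j + 2)) heuler
  have hcount' := Nat.mul_le_mul_right (4 + c) hcount
  have hck' := Nat.mul_le_mul_right m hck
  linarith

end LightEdge

/-! ### Degenerate graphs and group colorings -/

section Degenerate

variable {V : Type*} {G : SimpleGraph V}

open scoped Classical in
/-- Every nonempty finite set of vertices contains a vertex with fewer than `k` neighbours in the
set; in the usual terminology, `G` is `(k - 1)`-degenerate. -/
def IsStrictlyDegenerate (G : SimpleGraph V) (k : ℕ) : Prop :=
  ∀ S : Finset V, S.Nonempty → ∃ v ∈ S, #{w ∈ S | G.Adj v w} < k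

theorem IsStrictlyDegenerate.pos [Nonempty V] {k : ℕ} (hG : IsStrictlyDegenerate G k) : 0 < k := by
  obtain ⟨v, -, hv⟩ := hG {Classical.arbitrary V} (Finset.singleton_nonempty _)
  exact Nat.zero_lt_of_lt hv

/-- The maps `π` encode conflicts of colors: the color of `v` must not be `π v w b` if the adjacent
vertex `w` has the color `b`. -/
theorem forall_adj_update_ne [DecidableEq V] {A : Type*} {π : V → V → A → A}
    (hπ : ∀ v w, G.Adj v w → ∀ a b, a = π v w b → b = π w v a) {S : Finset V} {v : V} {c : V → A}
    (hc : ∀ x ∈ S.erase v, ∀ y ∈ S.erase v, G.Adj x y → c x ≠ π x y (c y)) {a : A}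
    (ha : ∀ w ∈ S, G.Adj v w → a ≠ π v w (c w)) :
    ∀ x ∈ S, ∀ y ∈ S, G.Adj x y →
      Function.update c v a x ≠ π x y (Function.update c v a y) := by
  intro x hx y hy hxy
  rcases eq_or_ne x v with rfl | hxv
  · rw [Function.update_self, Function.update_of_ne hxy.ne']
    exact ha y hy hxy
  rcases eq_or_ne y v with rfl | hyv
  · rw [Function.update_self, Function.update_of_ne hxv]
    exact fun h => ha x hx hxy.symm (hπ _ _ hxy _ _ h)
  · rw [Function.update_of_ne hxv, Function.update_of_ne hyv]
    exact hc x (Finset.mem_erase.2 ⟨hxv, hx⟩) y (Finset.mem_erase.2 ⟨hyv, hy⟩) hxy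

theorem IsStrictlyDegenerate.exists_forall_adj_ne [Finite V] {k : ℕ}
    (hG : IsStrictlyDegenerate G k) {A : Type*} {L : V → Finset A} (hL : ∀ v, k ≤ #(L v))
    {π : V → V → A → A} (hπ : ∀ v w, G.Adj v w → ∀ a b, a = π v w b → b = π w v a) :
    ∃ c : V → A, (∀ v, c v ∈ L v) ∧ ∀ v w, G.Adj v w → c v ≠ π v w (c w) := by
  classical
  have := Fintype.ofFinite V
  suffices h : ∀ S : Finset V, ∃ c : V → A, (∀ v, c v ∈ L v) ∧
      ∀ v ∈ S, ∀ w ∈ S, G.Adj v w → c v ≠ π v w (c w) by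
    simpa using h Finset.univ
  intro S
  induction S using Finset.strongInduction with | _ S ih =>
  rcases S.eq_empty_or_nonempty with rfl | hS
  · have hL_nonempty (v : V) : (L v).Nonempty :=
      have : Nonempty V := ⟨v⟩
      Finset.card_pos.1 (hG.pos.trans_le (hL v))
    choose c hc using hL_nonempty
    exact ⟨c, hc, by simp⟩
  obtain ⟨v, hvS, hv⟩ := hG S hS
  obtain ⟨c, hcL, hc⟩ := ih (S.erase v) (Finset.erase_ssubset hvS)
  obtain ⟨a, haL, ha⟩ : ∃ a ∈ L v, a ∉ {w ∈ S | G.Adj v w}.image fun w => π v w (c w) :=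
    Finset.exists_mem_notMem_of_card_lt_card (Finset.card_image_le.trans_lt (hv.trans_le (hL v)))
  refine ⟨Function.update c v a, fun w => ?_, forall_adj_update_ne hπ hc fun w hw hvw h =>
    ha (Finset.mem_image.2 ⟨w, Finset.mem_filter.2 ⟨hw, hvw⟩, h.symm⟩)⟩
  rcases eq_or_ne w v with rfl | hwv
  · rwa [Function.update_self]
  · rw [Function.update_of_ne hwv]
    exact hcL w

open scoped Classical in
theorem card_lineGraph_adj_add_two_le [Fintype V] {S : Finset G.edgeSet} {H : SimpleGraph V}
    (hSH : ∀ e ∈ S, (e : Sym2 V) ∈ H.edgeSet) {x y : V} (hxy : G.Adj x y)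
    (hS : ⟨s(x, y), hxy⟩ ∈ S) :
    #{e ∈ S | G.lineGraph.Adj ⟨s(x, y), hxy⟩ e} + 2 ≤ H.degree x + H.degree y := by
  have card_erase {v : V} (hv : v ∈ s(x, y)) :
      #((H.incidenceFinset v).erase s(x, y)) + 1 = H.degree v := by
    rw [Finset.card_erase_add_one, H.card_incidenceFinset_eq_degree]
    exact (H.mem_incidenceFinset _ _).2 ⟨hSH _ hS, hv⟩
  have hsub : {e ∈ S | G.lineGraph.Adj ⟨s(x, y), hxy⟩ e}.map (.subtype _) ⊆
      (H.incidenceFinset x).erase s(x, y) ∪ (H.incidenceFinset y).erase s(x, y) := by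
    intro e he
    obtain ⟨e, he_filter, rfl⟩ := Finset.mem_map.1 he
    obtain ⟨heS, hadj⟩ := Finset.mem_filter.1 he_filter
    obtain ⟨hne, v, hv, hve⟩ := SimpleGraph.lineGraph_adj_iff_exists.1 hadj
    have hne' : (e : Sym2 V) ≠ s(x, y) := fun h => hne (Subtype.ext h.symm)
    simp only [Finset.mem_union, Finset.mem_erase, SimpleGraph.mem_incidenceFinset]
    rcases Sym2.mem_iff.1 hv with rfl | rfl
    · exact .inl ⟨hne', hSH _ heS, hve⟩
    · exact .inr ⟨hne', hSH _ heS, hve⟩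
  have hcard := (Finset.card_le_card hsub).trans (Finset.card_union_le _ _)
  rw [Finset.card_map] at hcard
  rw [← card_erase (Sym2.mem_mk_left x y), ← card_erase (Sym2.mem_mk_right x y)]
  omega

open scoped Classical in
theorem isStrictlyDegenerate_lineGraph [Fintype V] {k : ℕ}
    (hlight : ∀ H ≤ G, H ≠ ⊥ → ∃ x y, H.Adj x y ∧ H.degree x + H.degree y ≤ k + 1) :
    IsStrictlyDegenerate G.lineGraph k := by
  intro S hS
  obtain ⟨H, hHG, hadj_iff⟩ :
      ∃ H ≤ G, ∀ {x y}, H.Adj x y ↔ ∃ h : G.Adj x y, (⟨s(x, y), h⟩ : G.edgeSet) ∈ S :=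
    ⟨_, fromEdgeSet_image_coe_le S, fromEdgeSet_image_coe_adj⟩
  have hSH : ∀ e ∈ S, (e : Sym2 V) ∈ H.edgeSet := by
    rintro ⟨e, he⟩ heS
    induction e with | _ x y =>
    exact hadj_iff.2 ⟨he, heS⟩
  obtain ⟨e, heS⟩ := hS
  have hne : H ≠ ⊥ := SimpleGraph.edgeSet_nonempty.1 ⟨e, hSH e heS⟩
  obtain ⟨x, y, hadj, hdeg⟩ := hlight H hHG hne
  obtain ⟨hxy, hxyS⟩ := hadj_iff.1 hadj
  have := card_lineGraph_adj_add_two_le hSH hxy hxyS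
  exact ⟨_, hxyS, by omega⟩

end Degenerate

section GroupColoring

variable {V : Type u} {G : SimpleGraph V} {A : Type w} [AddCommGroup A]

open scoped Classical in
/-- The values of `f` as an antisymmetric function on pairs of adjacent vertices: `f (vw)` if `vw`
is directed from `v` to `w`, and `-f (wv)` if it is directed from `w` to `v`. -/
noncomputable def signedLabel (D : G.EdgeOrientation) (f : G.edgeSet → A) (v w : V) : A :=
  if h : D.Dir v w then f ⟨s(v, w), D.adj_of_dir h⟩
  else if h : D.Dir w v then -f ⟨s(w, v), D.adj_of_dir h⟩ else 0

theorem signedLabel_of_dir {D : G.EdgeOrientation} {f : G.edgeSet → A} {v w : V}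
    (h : D.Dir v w) : signedLabel D f v w = f ⟨s(v, w), D.adj_of_dir h⟩ :=
  dif_pos h

theorem signedLabel_swap (D : G.EdgeOrientation) (f : G.edgeSet → A) (v w : V) :
    signedLabel D f w v = -signedLabel D f v w := by
  unfold signedLabel
  split_ifs with hwv hvw
  · exact absurd hwv (D.asymm hvw)
  all_goals simp

theorem isGroupChoosable_of_isStrictlyDegenerate [Finite V] {k : ℕ}
    (hG : IsStrictlyDegenerate G k) : SimpleGraph.IsGroupChoosable.{u, w} G k := by
  intro A _ _ L hL D f
  obtain ⟨c, hcL, hc⟩ := hG.exists_forall_adj_ne (fun v => (hL v).ge)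
    (π := fun v w b => signedLabel D f v w + b) fun v w _ a b h => by
      rw [signedLabel_swap D f v w, h, neg_add_cancel_left]
  refine ⟨c, fun v w h heq => hc v w (D.adj_of_dir h) ?_, hcL⟩
  rw [signedLabel_of_dir h, ← heq, sub_add_cancel]

theorem isGroupColorable_of_isGroupChoosable {k : ℕ}
    (hG : SimpleGraph.IsGroupChoosable.{u, w} G k) (hA : k ≤ ENat.card A) :
    G.IsGroupColorable A := by
  intro D f
  obtain ⟨t, -, ht⟩ := Set.exists_subset_encard_eq (Set.encard_univ A ▸ hA)
  lift t to Finset A using Set.finite_of_encard_eq_coe ht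
  rw [Set.encard_coe_eq_coe_finsetCard, Nat.cast_inj] at ht
  obtain ⟨c, hc, -⟩ := hG A hA (fun _ => t) (fun _ => ht) D f
  exact ⟨c, hc⟩

theorem groupChromaticNumber_le_groupChoiceNumber (G : SimpleGraph V) :
    SimpleGraph.groupChromaticNumber.{u, w} G ≤ SimpleGraph.groupChoiceNumber.{u, w} G := by
  refine le_iInf₂ fun k hk => iInf₂_le k ?_
  intro A _ hA
  exact isGroupColorable_of_isGroupChoosable hk hA

theorem nonempty_edgeOrientation (G : SimpleGraph V) : Nonempty G.EdgeOrientation :=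
  ⟨{ Dir := fun u v => G.Adj u v ∧ WellOrderingRel u v
     adj_of_dir := And.left
     dir_or_dir := fun {u v} h => by
      rcases trichotomous_of WellOrderingRel u v with huv | huv | hvu
      · exact .inl ⟨h, huv⟩
      · exact absurd huv h.ne
      · exact .inr ⟨h.symm, hvu⟩
     asymm := fun h h' => asymm_of WellOrderingRel h.2 h'.2 }⟩

theorem card_le_natCard_of_isGroupColorable [Finite A] (hG : G.IsGroupColorable A)
    {K : Finset V} (hK : G.IsClique K) : #K ≤ Nat.card A := by
  obtain ⟨D⟩ := nonempty_edgeOrientation G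
  obtain ⟨c, hc⟩ := hG D 0
  have hinj : Set.InjOn c K := by
    intro u hu v hv huv
    by_contra hne
    rcases D.dir_or_dir (hK hu hv hne) with h | h
    · exact hc u v h (by simp [huv])
    · exact hc v u h (by simp [huv])
  rw [← Set.ncard_coe_finset, ← Set.ncard_univ, ← hinj.ncard_image]
  exact Set.ncard_le_ncard (Set.subset_univ _)

theorem card_le_groupChromaticNumber_of_isClique {K : Finset V} (hK : G.IsClique K)
    (hcard : 1 < #K) : #K ≤ SimpleGraph.groupChromaticNumber.{u, w} G := by
  refine le_iInf₂ fun m hm => Nat.cast_le.2 ?_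
  have : NeZero (max m 1) := ⟨by omega⟩
  have hcard_group : Nat.card (ULift.{w} (ZMod (max m 1))) = max m 1 := by
    rw [Nat.card_ulift, Nat.card_zmod]
  have hcolor : G.IsGroupColorable (ULift.{w} (ZMod (max m 1))) := hm _ <| by
    rw [ENat.card_eq_coe_natCard, hcard_group]
    exact Nat.cast_le.2 (le_max_left m 1)
  have hle := card_le_natCard_of_isGroupColorable hcolor hK
  rw [hcard_group] at hle
  omega

end GroupColoring

section MainTheorem

variable {V : Type u} [Fintype V] {G : SimpleGraph V} [DecidableRel G.Adj]

theorem exists_isClique_lineGraph_card_eq_degree (v : V) :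
    ∃ K : Finset G.edgeSet, G.lineGraph.IsClique K ∧ #K = G.degree v := by
  classical
  refine ⟨(G.incidenceFinset v).subtype (· ∈ G.edgeSet), fun e he e' he' hne => ?_, ?_⟩
  · rw [Finset.mem_coe, Finset.mem_subtype, SimpleGraph.mem_incidenceFinset] at he he'
    exact SimpleGraph.lineGraph_adj_iff_exists.2 ⟨hne, v, he.2, he'.2⟩
  · rw [Finset.card_subtype, Finset.filter_true_of_mem, G.card_incidenceFinset_eq_degree]
    exact fun e he => G.incidenceFinset_subset v he |> SimpleGraph.mem_edgeFinset.1

theorem maxDegree_le_groupEdgeChromaticNumber (hG : 1 < G.maxDegree) :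
    G.maxDegree ≤ SimpleGraph.groupEdgeChromaticNumber.{u, w} G := by
  have : Nonempty V := by
    by_contra hV
    rw [not_nonempty_iff] at hV
    simp at hG
  obtain ⟨v, hv⟩ := G.exists_maximal_degree_vertex
  obtain ⟨K, hK, hcard⟩ := exists_isClique_lineGraph_card_eq_degree (G := G) v
  rw [hv, ← hcard] at hG ⊢
  exact card_le_groupChromaticNumber_of_isClique hK hG

theorem groupEdgeChoiceNumber_le_maxDegree_of_isPlanar (hG : G.IsPlanar) {c : ℕ}
    (hc : 8 ≤ c * (G.maxDegree - 2)) (hgirth : (4 + c : ℕ) ≤ G.egirth) :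
    SimpleGraph.groupEdgeChoiceNumber.{u, w} G ≤ G.maxDegree := by
  classical
  refine iInf₂_le G.maxDegree (isGroupChoosable_of_isStrictlyDegenerate
    (isStrictlyDegenerate_lineGraph fun H hHG hH => ?_))
  exact exists_adj_degree_add_degree_le_of_isPlanar (isPlanar_of_le hHG hG) hH hc
    (hgirth.trans (SimpleGraph.egirth_anti hHG)) fun v =>
      (SimpleGraph.degree_le_of_le hHG).trans (G.degree_le_maxDegree v)

end MainTheorem

theorem le_ceil_div_mul {K : Type*} [Field K] [LinearOrder K] [IsStrictOrderedRing K]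
    [FloorSemiring K] {a b : K} (hb : 0 < b) : a ≤ ⌈a / b⌉₊ * b :=
  (div_le_iff₀ hb).1 (Nat.le_ceil _)

theorem mainTheorem2 {V : Type u} [Fintype V] (G : SimpleGraph V) [DecidableRel G.Adj]
    (hG : G.IsPlanar) (d : ℕ) (hd : 3 ≤ d) (hdG : d ≤ G.maxDegree)
    (hgirth : ((4 + ⌈(8 : ℚ) / ((d : ℚ) - 2)⌉₊ : ℕ) : ℕ∞) ≤ G.egirth) :
    SimpleGraph.groupEdgeChromaticNumber.{u, w} G = (G.maxDegree : ℕ∞) ∧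
      SimpleGraph.groupEdgeChoiceNumber.{u, w} G = (G.maxDegree : ℕ∞) := by
  have hpos : (0 : ℚ) < (d - 2 : ℕ) := Nat.cast_pos.2 (by omega)
  have hcast : ((d - 2 : ℕ) : ℚ) = d - 2 := by rw [Nat.cast_sub (by omega), Nat.cast_two]
  rw [← hcast] at hgirth
  have hceil : 8 ≤ ⌈(8 : ℚ) / (d - 2 : ℕ)⌉₊ * (d - 2) := by
    exact_mod_cast le_ceil_div_mul (a := (8 : ℚ)) hpos
  have hlower := maxDegree_le_groupEdgeChromaticNumber.{u, w} (G := G) (by omega)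
  have hmiddle := groupChromaticNumber_le_groupChoiceNumber.{_, w} G.lineGraph
  have hupper := groupEdgeChoiceNumber_le_maxDegree_of_isPlanar.{u, w} hG
    (hceil.trans (Nat.mul_le_mul_left _ (Nat.sub_le_sub_right hdG 2))) hgirth
  exact ⟨(hmiddle.trans hupper).antisymm hlower, hupper.antisymm (hlower.trans hmiddle)⟩
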